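/- All Banach spaces are real, and operators are bounded and linear. For a Banach space $X$ write $B(X)$ for its closed unit ball and $S(X)$ for its unit sphere. $X$ has the Daugavet property if $\|\mathrm{Id}+R\|=1+\|R\|$ for every operator $R\colon X\to X$ of rank $1$. For operators $T\colon X\to Y$ and $T_1\colon X\to Y_1$ into Banach spaces, the formal sum is $T\mathbin{\tilde+}T_1\colon X\to Y\oplus_1 Y_1$, $x\mapsto (Tx,T_1x)$, so that $\|(T\mathbin{\tilde+}T_1)x\|=\|Tx\|+\|T_1x\|$. An operator $T\colon X\to Y$ is a strong Daugavet operator if for all $x,y\in S(X)$ and $\varepsilon>0$ there is $z\in S(X)$ with $\|T(z-y)\|<\varepsilon$ and $\|z+x\|>2-\varepsilon$; it is narrow if $T\mathbin{\tilde+}x^*$ is a strong Daugavet operator for every $x^*\in X^*$. It is a strong Radon–Nikodým operator if the closed bounded convex set $K=\overline{T(B(X))}$ has the Radon–Nikodým property: for every probability space $(\Omega,\Sigma,P)$, every countably additive $m\colon\Sigma\to Y$ with $m(A)=0$ whenever $P(A)=0$ and $m(A)/P(A)\in K$ whenever $P(A)>0$ is of the form $m(A)=\int_A f\,dP$ $(A\in\Sigma)$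 for some Bochner integrable $f\colon\Omega\to Y$. Two operators $T,T'$ on $X$ are identified if $\|Tx\|=\|T'x\|$ for all $x\in X$; under this identification let $\mathcal{NAR}(X)$ and $\mathcal{SRN}(X)$ be the sets of narrow and of strong Radon–Nikodým operators on $X$, and for sets of operators put $\mathcal M_1\mathbin{\tilde+}\mathcal M_2=\{T_1\mathbin{\tilde+}T_2: T_1\in\mathcal M_1,\ T_2\in\mathcal M_2\}$. **Theorem.** Let $X$ be a Banach space with the Daugavet property, let $T$ be a narrow operator and $T_1$ a strong Radon–Nikodým operator on $X$. Then $T\mathbin{\tilde+}T_1$ is narrow; that is, $\mathcal{NAR}(X)\mathbin{\tilde+}\mathcal{SRN}(X)=\mathcal{NAR}(X)$. In particular, every strong Radon–Nikodým operator on $X$ is narrow. -/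

import Mathlib

open MeasureTheory

universe u v w

/-- A real normed space `X` has the Daugavet property if every bounded linear operator
`T : X → X` of rank one satisfies `‖Id + T‖ = 1 + ‖T‖`. -/
def DaugavetProperty (X : Type u) [NormedAddCommGroup X] [NormedSpace ℝ X] : Prop :=
  ∀ T : X →L[ℝ] X, Module.finrank ℝ (LinearMap.range (T : X →ₗ[ℝ] X)) = 1 →
    ‖ContinuousLinearMap.id ℝ X + T‖ = 1 + ‖T‖

/-- The formal sum `x ↦ (T₁ x, T₂ x)`, with values in the `ℓ₁`-sum of the two range spaces. -/
noncomputable def formalSum {X : Type u} [NormedAddCommGroup X] [NormedSpace ℝ X]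
    {Y : Type v} [NormedAddCommGroup Y] [NormedSpace ℝ Y]
    {Z : Type w} [NormedAddCommGroup Z] [NormedSpace ℝ Z]
    (T₁ : X →L[ℝ] Y) (T₂ : X →L[ℝ] Z) : X →L[ℝ] WithLp 1 (Y × Z) :=
  ((WithLp.prodContinuousLinearEquiv 1 ℝ Y Z).symm : (Y × Z) →L[ℝ] WithLp 1 (Y × Z)).comp
    (T₁.prod T₂)

theorem norm_formalSum_apply {X : Type u} [NormedAddCommGroup X] [NormedSpace ℝ X]
    {Y : Type v} [NormedAddCommGroup Y] [NormedSpace ℝ Y]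
    {Z : Type w} [NormedAddCommGroup Z] [NormedSpace ℝ Z]
    (T₁ : X →L[ℝ] Y) (T₂ : X →L[ℝ] Z) (x : X) :
    ‖formalSum T₁ T₂ x‖ = ‖T₁ x‖ + ‖T₂ x‖ := by
  simp [formalSum, WithLp.prod_norm_eq_of_L1]

/-- `T` is a strong Daugavet operator: for all `x, y` in the unit sphere and all `ε > 0` there is
`z` in the unit sphere with `‖T (z - y)‖ < ε` and `‖z + x‖ > 2 - ε`. -/
def IsStrongDaugavet {X : Type u} [NormedAddCommGroup X] [NormedSpace ℝ X]
    {Y : Type v} [NormedAddCommGroup Y] [NormedSpace ℝ Y] (T : X →L[ℝ] Y) : Prop :=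
  ∀ x y : X, ‖x‖ = 1 → ‖y‖ = 1 → ∀ ε : ℝ, 0 < ε →
    ∃ z : X, ‖z‖ = 1 ∧ ‖T (z - y)‖ < ε ∧ 2 - ε < ‖z + x‖

/-- `T` is narrow: its formal sum with every bounded functional is a strong Daugavet operator. -/
def IsNarrow {X : Type u} [NormedAddCommGroup X] [NormedSpace ℝ X]
    {Y : Type v} [NormedAddCommGroup Y] [NormedSpace ℝ Y] (T : X →L[ℝ] Y) : Prop :=
  ∀ f : X →L[ℝ] ℝ, IsStrongDaugavet (formalSum T f)

/-- The Radon–Nikodým property of a closed bounded convex subset `K` of a Banach space: on every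
probability space `(Ω, P)`, every countably additive vector measure `m` that vanishes on `P`-null
sets and whose average range `{m A / P A : P A > 0}` lies in `K` has a Bochner integrable density
with respect to `P`. -/
def HasRadonNikodymProperty {Y : Type v} [NormedAddCommGroup Y] [NormedSpace ℝ Y]
    (K : Set Y) : Prop :=
  ∀ (Ω : Type) [MeasurableSpace Ω] (P : Measure Ω) [IsProbabilityMeasure P]
    (m : VectorMeasure Ω Y),
    (∀ A : Set Ω, MeasurableSet A → P A = 0 → m A = 0) →
    (∀ A : Set Ω, MeasurableSet A → 0 < P A → (P.real A)⁻¹ • m A ∈ K) →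
    ∃ f : Ω → Y, Integrable f P ∧ ∀ A : Set Ω, MeasurableSet A → m A = ∫ ω in A, f ω ∂P

/-- `T` is a strong Radon–Nikodým operator: the closure of the image of the closed unit ball
(a closed bounded convex set) has the Radon–Nikodým property. -/
def IsStrongRadonNikodym {X : Type u} [NormedAddCommGroup X] [NormedSpace ℝ X]
    {Y : Type v} [NormedAddCommGroup Y] [NormedSpace ℝ Y] (T : X →L[ℝ] Y) : Prop :=
  HasRadonNikodymProperty (closure (T '' Metric.closedBall (0 : X) 1))

/-- A bounded linear operator on `X` bundled with its range space, a real Banach space. -/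
structure BanachOperator (X : Type u) [NormedAddCommGroup X] [NormedSpace ℝ X] :
    Type (max u (v + 1)) where
  cod : Type v
  [normedGroup : NormedAddCommGroup cod]
  [normedSpace : NormedSpace ℝ cod]
  [complete : CompleteSpace cod]
  op : X →L[ℝ] cod

attribute [instance] BanachOperator.normedGroup BanachOperator.normedSpace
  BanachOperator.complete

/-- Two operators on `X` are equivalent if `‖T₁ x‖ = ‖T₂ x‖` for all `x`. -/
def operatorSetoid (X : Type u) [NormedAddCommGroup X] [NormedSpace ℝ X] :
    Setoid (BanachOperator.{u, v} X) where
  r T₁ T₂ := ∀ x : X, ‖T₁.op x‖ = ‖T₂.op x‖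
  iseqv := ⟨fun _ _ => rfl, fun h x => (h x).symm, fun h h' x => (h x).trans (h' x)⟩

/-- The operators on `X`, with equivalent operators identified. -/
def OP (X : Type u) [NormedAddCommGroup X] [NormedSpace ℝ X] : Type (max u (v + 1)) :=
  Quotient (operatorSetoid.{u, v} X)

namespace OP

/-- The class in `OP X` of an operator on `X`. -/
def mk {X : Type u} [NormedAddCommGroup X] [NormedSpace ℝ X]
    {Y : Type v} [NormedAddCommGroup Y] [NormedSpace ℝ Y] [CompleteSpace Y]
    (T : X →L[ℝ] Y) : OP.{u, v} X :=
  Quotient.mk (operatorSetoid.{u, v} X) ⟨Y, T⟩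

/-- The formal sum of classes of operators. -/
noncomputable def add {X : Type u} [NormedAddCommGroup X] [NormedSpace ℝ X] :
    OP.{u, v} X → OP.{u, v} X → OP.{u, v} X :=
  Quotient.lift₂ (fun S T => OP.mk (formalSum S.op T.op)) (by
    intro S T S' T' hS hT
    apply Quotient.sound
    intro x
    have h₁ : ‖S.op x‖ = ‖S'.op x‖ := hS x
    have h₂ : ‖T.op x‖ = ‖T'.op x‖ := hT x
    change ‖formalSum S.op T.op x‖ = ‖formalSum S'.op T'.op x‖
    rw [norm_formalSum_apply, norm_formalSum_apply, h₁, h₂])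

/-- The formal sum of two sets of (classes of) operators. -/
def setSum {X : Type u} [NormedAddCommGroup X] [NormedSpace ℝ X]
    (M₁ M₂ : Set (OP.{u, v} X)) : Set (OP.{u, v} X) :=
  {c | ∃ a ∈ M₁, ∃ b ∈ M₂, c = OP.add a b}

/-- The set of (classes of) narrow operators on `X`. -/
def NAR (X : Type u) [NormedAddCommGroup X] [NormedSpace ℝ X] : Set (OP.{u, v} X) :=
  {c | ∃ T : BanachOperator.{u, v} X, IsNarrow T.op ∧ c = OP.mk T.op}

/-- The set of (classes of) strong Radon–Nikodým operators on `X`. -/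
def SRN (X : Type u) [NormedAddCommGroup X] [NormedSpace ℝ X] : Set (OP.{u, v} X) :=
  {c | ∃ T : BanachOperator.{u, v} X, IsStrongRadonNikodym T.op ∧ c = OP.mk T.op}

end OP

/-! Fix unit vectors `x`, `y` and a functional `f`. Absorbing `f` into `T₁` gives `T₂ = T₁ +~ f`,
which is again strong Radon–Nikodým since the scalars have the Radon–Nikodým property. Then every
slice of the ball contains a slice on which `T₂` is nearly constant, so by Hahn–Banach `y` is close
to a convex combination `∑ wᵢ dᵢ` of unit vectors `dᵢ` lying in such slices. Narrowness of `T`,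
tested with the functional that defines the `i`-th slice, replaces `dᵢ` by `zᵢ` in the same slice
with `T zᵢ ≈ T dᵢ`; there `T₂ zᵢ ≈ T₂ dᵢ` is automatic. Choosing the `zᵢ` one after another, each
almost norm-additive to the sum already formed, makes `‖x + ∑ wᵢ zᵢ‖` almost `2`. So `z = ∑ wᵢ zᵢ`
is the required vector.

The small slices come from a martingale argument (`IsStrongRadonNikodym.exists_small_slice`). If a
slice contained none, each of its points would be almost an average of points of the ball that lie
outside it or have a `T`-image at distance at least `δ`. Iterating gives a random walk whose
`T`-image is an approximate martingale with jumps of mean at least `δ / 2`. The Radon–Nikodým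
property forbids this: such a process has increments tending to zero in mean.

The Daugavet property makes the zero operator narrow; adding a strong Radon–Nikodým operator to it
gives the last claim. -/

/-! ### Approximate martingales in a set with the Radon–Nikodým property -/

section QuasiMartingale

open Filter Topology Set
open scoped symmDiff

variable {Ω : Type*} [mΩ : MeasurableSpace Ω] {P : Measure Ω} [IsProbabilityMeasure P]
  {E : Type*} [NormedAddCommGroup E] [NormedSpace ℝ E]

theorem measureDense_filtration (ℱ : Filtration ℕ mΩ) (hℱ : ⨆ n, ℱ n = mΩ) :
    P.MeasureDense {A | ∃ n, MeasurableSet[ℱ n] A} := by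
  refine Measure.MeasureDense.of_generateFrom_isSetAlgebra_finite P ⟨⟨0, @MeasurableSet.empty _ (ℱ 0)⟩, ?_, ?_⟩ ?_
  · rintro s ⟨n, hn⟩
    exact ⟨n, hn.compl⟩
  · rintro s t ⟨n, hn⟩ ⟨k, hk⟩
    exact ⟨max n k, (ℱ.mono (le_max_left n k) _ hn).union (ℱ.mono (le_max_right n k) _ hk)⟩
  · apply le_antisymm
    · conv_lhs => rw [← hℱ]
      exact iSup_le fun n A hA => MeasurableSpace.measurableSet_generateFrom ⟨n, hA⟩
    · refine MeasurableSpace.generateFrom_le ?_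
      rintro A ⟨n, hn⟩
      exact ℱ.le n A hn

theorem norm_setIntegral_sub_setIntegral_le_symmDiff {g : Ω → E} {C : ℝ} (hg : Integrable g P)
    (hC : ∀ ω, ‖g ω‖ ≤ C) {A B : Set Ω} (hA : MeasurableSet A) (hB : MeasurableSet B) :
    ‖(∫ ω in A, g ω ∂P) - ∫ ω in B, g ω ∂P‖ ≤ C * P.real (A ∆ B) := by
  rw [← integral_indicator hA, ← integral_indicator hB,
    ← integral_sub (hg.indicator hA) (hg.indicator hB)]
  calc ‖∫ ω, A.indicator g ω - B.indicator g ω ∂P‖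
      ≤ ∫ ω, (A ∆ B).indicator (fun _ => C) ω ∂P := by
        refine norm_integral_le_of_norm_le
          ((integrable_const C).indicator (hA.symmDiff hB)) (Eventually.of_forall fun ω => ?_)
        by_cases h₁ : ω ∈ A <;> by_cases h₂ : ω ∈ B <;>
          simp [h₁, h₂, mem_symmDiff, hC ω]
    _ = C * P.real (A ∆ B) := by
        rw [integral_indicator (hA.symmDiff hB)]
        simp [mul_comm]

/-- On sets known at a finite time the hypothesis `hstep` controls the integrals directly. A general
set is approximated by such sets, and the uniform bound `C` makes the error independent of `n`. -/
theorem cauchySeq_setIntegral_of_filtration (ℱ : Filtration ℕ mΩ) (hℱ : ⨆ n, ℱ n = mΩ)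
    {g : ℕ → Ω → E} {C : ℝ} (hg : ∀ n, Integrable (g n) P) (hC : ∀ n ω, ‖g n ω‖ ≤ C)
    {r : ℕ → ℝ} (hr : Tendsto r atTop (𝓝 0))
    (hstep : ∀ n N, n ≤ N → ∀ A, MeasurableSet[ℱ n] A →
      ‖(∫ ω in A, g N ω ∂P) - ∫ ω in A, g n ω ∂P‖ ≤ r n * P.real A)
    {A : Set Ω} (hA : MeasurableSet A) : CauchySeq fun n => ∫ ω in A, g n ω ∂P := by
  rw [Metric.cauchySeq_iff']
  intro ε hε
  have hC0 : 0 < |C| + 1 := by positivity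
  obtain ⟨B, ⟨k, hB⟩, hAB⟩ := (measureDense_filtration (P := P) ℱ hℱ).approx A hA
    (measure_ne_top _ _) (ε / (4 * (|C| + 1))) (by positivity)
  have hB' := ℱ.le k B hB
  have hAB' : P.real (A ∆ B) < ε / (4 * (|C| + 1)) := by
    rw [measureReal_def]
    exact (ENNReal.toReal_lt_of_lt_ofReal hAB)
  have key : ∀ n, ‖(∫ ω in A, g n ω ∂P) - ∫ ω in B, g n ω ∂P‖ ≤ ε / 4 := fun n => by
    refine (norm_setIntegral_sub_setIntegral_le_symmDiff (hg n)
      (fun ω => (hC n ω).trans ((le_abs_self C).trans (le_add_of_nonneg_right zero_le_one)))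
      hA hB').trans ?_
    calc (|C| + 1) * P.real (A ∆ B) ≤ (|C| + 1) * (ε / (4 * (|C| + 1))) := by gcongr
      _ = ε / 4 := by field_simp
  obtain ⟨N, hN⟩ := ((hr.eventually (gt_mem_nhds (show (0 : ℝ) < ε / 4 by positivity))).and
    (eventually_ge_atTop k)).exists
  refine ⟨N, fun n hn => ?_⟩
  have h₁ := hstep N n hn B (ℱ.mono hN.2 _ hB)
  have h₂ : r N * P.real B ≤ ε / 4 := by
    have := measureReal_le_one (μ := P) (s := B)
    have h0 : 0 ≤ P.real B := measureReal_nonneg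
    nlinarith [hN.1]
  have h₃ := key n
  have h₄ := key N
  rw [dist_eq_norm]
  have : (∫ ω in A, g n ω ∂P) - ∫ ω in A, g N ω ∂P =
    ((∫ ω in A, g n ω ∂P) - ∫ ω in B, g n ω ∂P) +
    ((∫ ω in B, g n ω ∂P) - ∫ ω in B, g N ω ∂P) -
    ((∫ ω in A, g N ω ∂P) - ∫ ω in B, g N ω ∂P) := by abel
  rw [this]
  refine (norm_sub_le _ _).trans_lt ?_
  have := norm_add_le ((∫ ω in A, g n ω ∂P) - ∫ ω in B, g n ω ∂P)
    ((∫ ω in B, g n ω ∂P) - ∫ ω in B, g N ω ∂P)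
  linarith

/-- The setwise limit of the integrals is dominated by `|C| • P`, which upgrades finite to countable
additivity. Its averages are limits of averages of `g n`, hence stay in the closed convex set `K`,
and `F` is its density. -/
theorem HasRadonNikodymProperty.exists_tendsto_setIntegral {Ω : Type} [mΩ : MeasurableSpace Ω]
    {P : Measure Ω} [IsProbabilityMeasure P] [CompleteSpace E] {K : Set E}
    (hK : HasRadonNikodymProperty K) (hKc : IsClosed K) (hKconv : Convex ℝ K)
    {g : ℕ → Ω → E} {C : ℝ} (hg : ∀ n, Integrable (g n) P) (hC : ∀ n ω, ‖g n ω‖ ≤ C)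
    (hgK : ∀ n ω, g n ω ∈ K)
    (hcau : ∀ A, MeasurableSet A → CauchySeq fun n => ∫ ω in A, g n ω ∂P) :
    ∃ F : Ω → E, Integrable F P ∧ ∀ A, MeasurableSet A →
      Tendsto (fun n => ∫ ω in A, g n ω ∂P) atTop (𝓝 (∫ ω in A, F ω ∂P)) := by
  classical
  have hlim : ∀ A, MeasurableSet A → ∃ y, Tendsto (fun n => ∫ ω in A, g n ω ∂P) atTop (𝓝 y) :=
    fun A hA => cauchySeq_tendsto_of_complete (hcau A hA)
  let m : Set Ω → E := fun A => if hA : MeasurableSet A then (hlim A hA).choose else 0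
  have hm : ∀ A, MeasurableSet A → Tendsto (fun n => ∫ ω in A, g n ω ∂P) atTop (𝓝 (m A)) := by
    intro A hA
    simp only [m, hA, dif_pos]
    exact (hlim A hA).choose_spec
  have hm0 : ∀ A, ¬ MeasurableSet A → m A = 0 := fun A hA => by simp [m, hA]
  have hbound : ∀ A, MeasurableSet A → ‖m A‖ ≤ |C| * P.real A := by
    intro A hA
    refine le_of_tendsto (hm A hA).norm (Eventually.of_forall fun n => ?_)
    exact norm_setIntegral_le_of_norm_le_const (measure_lt_top _ _)
      (fun ω _ => (hC n ω).trans (le_abs_self C))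
  have hbound' : ∀ A, ‖m A‖ₑ ≤ (ENNReal.ofReal |C| • P) A := by
    intro A
    by_cases hA : MeasurableSet A
    · rw [Measure.smul_apply, smul_eq_mul, ← ofReal_norm]
      refine (ENNReal.ofReal_le_ofReal (hbound A hA)).trans ?_
      rw [ENNReal.ofReal_mul (abs_nonneg C), measureReal_def, ENNReal.ofReal_toReal
        (measure_ne_top _ _)]
    · simp [hm0 A hA]
  have hfin : IsFiniteMeasure (ENNReal.ofReal |C| • P) := Measure.smul_finite P (by simp)
  have hadd : ∀ s t, MeasurableSet s → MeasurableSet t → Disjoint s t →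
      m (s ∪ t) = m s + m t := by
    intro s t hs ht hst
    refine tendsto_nhds_unique (hm _ (hs.union ht)) (((hm s hs).add (hm t ht)).congr fun n => ?_)
    exact (setIntegral_union hst ht (hg n).integrableOn (hg n).integrableOn).symm
  let M : VectorMeasure Ω E := VectorMeasure.of_additive_of_le_measure m hbound' hadd hm0
  have hM : ∀ A, M A = m A := fun A => rfl
  obtain ⟨F, hF, hFA⟩ := hK Ω P M
    (fun A hA h0 => by
      have := hbound A hA
      rw [measureReal_def, h0] at this
      simpa [hM] using this)
    (fun A hA hpos => by
      rw [hM]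
      refine hKc.mem_of_tendsto ((hm A hA).const_smul (P.real A)⁻¹)
        (Eventually.of_forall fun n => ?_)
      have := hKconv.set_average_mem hKc hpos.ne' (measure_ne_top P A)
        (Eventually.of_forall fun ω => hgK n ω) (hg n).integrableOn
      rwa [setAverage_eq] at this)
  exact ⟨F, hF, fun A hA => by rw [← hFA A hA, hM]; exact hm A hA⟩

theorem exists_finite_range_approx_of_filtration {E : Type*} [NormedAddCommGroup E]
    (ℱ : Filtration ℕ mΩ) (hℱ : ⨆ n, ℱ n = mΩ)
    {F : Ω → E} (hF : Integrable F P) : ∀ ε : ℝ, 0 < ε →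
    ∃ n, ∃ G : Ω → E, StronglyMeasurable[ℱ n] G ∧ (range G).Finite ∧ Integrable G P ∧
      ∫ ω, ‖F ω - G ω‖ ∂P < ε := by
  refine Integrable.induction (fun F : Ω → E => ∀ ε : ℝ, 0 < ε →
    ∃ n, ∃ G : Ω → E, StronglyMeasurable[ℱ n] G ∧ (range G).Finite ∧ Integrable G P ∧
      ∫ ω, ‖F ω - G ω‖ ∂P < ε) ?_ ?_ ?_ ?_ hF
  · intro c s hs _ ε hε
    obtain ⟨B, ⟨k, hB⟩, hAB⟩ := (measureDense_filtration (P := P) ℱ hℱ).approx s hs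
      (measure_ne_top _ _) (ε / (‖c‖ + 1)) (by positivity)
    have hB' := ℱ.le k B hB
    have hAB' : P.real (s ∆ B) < ε / (‖c‖ + 1) := ENNReal.toReal_lt_of_lt_ofReal hAB
    refine ⟨k, B.indicator fun _ => c, ?_, ?_, (integrable_const c).indicator hB', ?_⟩
    · exact StronglyMeasurable.indicator (@stronglyMeasurable_const _ _ (ℱ k) _ _) hB
    · refine ((finite_singleton c).union (finite_singleton 0)).subset ?_
      rintro _ ⟨ω, rfl⟩
      by_cases h : ω ∈ B <;> simp [h]
    · calc ∫ ω, ‖s.indicator (fun _ => c) ω - B.indicator (fun _ => c) ω‖ ∂P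
          = ∫ ω, (s ∆ B).indicator (fun _ => ‖c‖) ω ∂P := by
            congr 1
            ext ω
            by_cases h₁ : ω ∈ s <;> by_cases h₂ : ω ∈ B <;> simp [h₁, h₂, mem_symmDiff]
        _ = P.real (s ∆ B) * ‖c‖ := by
            rw [integral_indicator (hs.symmDiff hB')]
            simp
        _ ≤ ε / (‖c‖ + 1) * ‖c‖ := by gcongr
        _ < ε := by
            rw [div_mul_eq_mul_div, div_lt_iff₀ (by positivity)]
            nlinarith
  · intro f g _ hf hg hf' hg' ε hε
    obtain ⟨n, G, hG₁, hG₂, hG₃, hG₄⟩ := hf' (ε / 2) (by positivity)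
    obtain ⟨k, H, hH₁, hH₂, hH₃, hH₄⟩ := hg' (ε / 2) (by positivity)
    refine ⟨max n k, fun ω => G ω + H ω, ?_, ?_, hG₃.add hH₃, ?_⟩
    · exact (hG₁.mono (ℱ.mono (le_max_left n k))).add (hH₁.mono (ℱ.mono (le_max_right n k)))
    · refine (hG₂.image2 (· + ·) hH₂).subset ?_
      rintro _ ⟨ω, rfl⟩
      exact ⟨_, mem_range_self ω, _, mem_range_self ω, rfl⟩
    · calc ∫ ω, ‖(f + g) ω - (G ω + H ω)‖ ∂P
          ≤ ∫ ω, ‖f ω - G ω‖ + ‖g ω - H ω‖ ∂P := by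
            refine integral_mono ((hf.add hg).sub (hG₃.add hH₃)).norm
              ((hf.sub hG₃).norm.add (hg.sub hH₃).norm) fun ω => ?_
            have : (f + g) ω - (G ω + H ω) = (f ω - G ω) + (g ω - H ω) := by
              simp only [Pi.add_apply]; abel
            simp only [this]
            exact norm_add_le _ _
        _ = _ := integral_add (hf.sub hG₃).norm (hg.sub hH₃).norm
        _ < ε := by linarith
  · rw [← isSeqClosed_iff_isClosed]
    intro f f₀ hf hlim ε hε
    have := (tendsto_iff_dist_tendsto_zero.1 hlim).eventually
      (gt_mem_nhds (show (0 : ℝ) < ε / 2 by positivity))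
    obtain ⟨k, hk⟩ := this.exists
    obtain ⟨n, G, hG₁, hG₂, hG₃, hG₄⟩ := hf k (ε / 2) (by positivity)
    refine ⟨n, G, hG₁, hG₂, hG₃, ?_⟩
    rw [dist_comm, dist_eq_norm, L1.norm_sub_eq_lintegral] at hk
    have h0 := L1.integrable_coeFn f₀
    have h1 := L1.integrable_coeFn (f k)
    have heq : ∫ ω, ‖f₀ ω - f k ω‖ ∂P = _ :=
      integral_norm_eq_lintegral_enorm (h0.sub h1).aestronglyMeasurable
    replace hk : ∫ ω, ‖f₀ ω - f k ω‖ ∂P < ε / 2 := heq.trans_lt hk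
    calc ∫ ω, ‖f₀ ω - G ω‖ ∂P ≤ ∫ ω, ‖f₀ ω - f k ω‖ + ‖f k ω - G ω‖ ∂P :=
          integral_mono (h0.sub hG₃).norm ((h0.sub h1).norm.add (h1.sub hG₃).norm)
            fun ω => norm_sub_le_norm_sub_add_norm_sub _ _ _
      _ = _ := integral_add (h0.sub h1).norm (h1.sub hG₃).norm
      _ < ε := by linarith
  · intro f g hfg _ hf ε hε
    obtain ⟨n, G, hG₁, hG₂, hG₃, hG₄⟩ := hf ε hε
    refine ⟨n, G, hG₁, hG₂, hG₃, ?_⟩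
    refine lt_of_eq_of_lt (integral_congr_ae (hfg.mono fun ω h => ?_)) hG₄
    simp only [h]

/-- On a level set `v` is constant, so there the norm of the integral is the integral of the norm.
This turns setwise bounds into bounds in mean. -/
theorem integral_norm_le_of_finite_range [CompleteSpace E] {m : MeasurableSpace Ω} (hm : m ≤ mΩ) {v : Ω → E}
    (hv : StronglyMeasurable[m] v) (hfin : (range v).Finite) {θ : Ω → ℝ} (hθ : Integrable θ P)
    (h : ∀ A, MeasurableSet[m] A → ‖∫ ω in A, v ω ∂P‖ ≤ ∫ ω in A, θ ω ∂P) :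
    ∫ ω, ‖v ω‖ ∂P ≤ ∫ ω, θ ω ∂P := by
  have hmeas : ∀ y, MeasurableSet[m] (v ⁻¹' {y}) := fun y => by
    borelize E
    exact @StronglyMeasurable.measurable _ _ _ m _ _ _ _ hv _ (measurableSet_singleton y)
  have hvint : Integrable v P := by
    obtain ⟨C, hC⟩ := hfin.isBounded.exists_norm_le
    exact Integrable.of_bound (hv.mono hm).aestronglyMeasurable C
      (Eventually.of_forall fun ω => hC _ (mem_range_self ω))
  have hU : (⋃ y ∈ hfin.toFinset, v ⁻¹' {y}) = univ := by
    ext ω; simp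
  have hsplit : ∀ f : Ω → ℝ, Integrable f P →
      ∫ ω, f ω ∂P = ∑ y ∈ hfin.toFinset, ∫ ω in v ⁻¹' {y}, f ω ∂P := by
    intro f hf
    rw [← setIntegral_univ, ← hU]
    refine integral_biUnion_finset _ (fun y _ => hm _ (hmeas y)) ?_ (fun y _ => hf.integrableOn)
    intro y _ z _ hyz
    exact Disjoint.preimage v (by simpa using hyz)
  rw [hsplit _ hvint.norm, hsplit _ hθ]
  refine Finset.sum_le_sum fun y _ => ?_
  refine le_trans (le_of_eq ?_) (h _ (hmeas y))
  rw [setIntegral_congr_fun (g := fun _ => ‖y‖) (hm _ (hmeas y))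
      (fun ω hω => by simp only [mem_preimage, mem_singleton_iff] at hω; simp [hω]),
    setIntegral_congr_fun (f := v) (g := fun _ => y) (hm _ (hmeas y)) (fun ω hω => hω)]
  simp [norm_smul, abs_of_nonneg measureReal_nonneg]

/-- Approximate martingales of simple functions with values in a set with the Radon–Nikodým
property have increments tending to zero in mean. -/
theorem HasRadonNikodymProperty.exists_integral_norm_sub_lt {Ω : Type} [mΩ : MeasurableSpace Ω]
    {P : Measure Ω} [IsProbabilityMeasure P] [CompleteSpace E] {K : Set E}
    (hK : HasRadonNikodymProperty K) (hKc : IsClosed K) (hKconv : Convex ℝ K)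
    (ℱ : Filtration ℕ mΩ) (hℱ : ⨆ n, ℱ n = mΩ)
    {g : ℕ → Ω → E} {C : ℝ} (hgm : ∀ n, StronglyMeasurable[ℱ n] (g n))
    (hgfin : ∀ n, (range (g n)).Finite) (hC : ∀ n ω, ‖g n ω‖ ≤ C)
    (hgK : ∀ n ω, g n ω ∈ K) {r : ℕ → ℝ} (hr : Tendsto r atTop (𝓝 0))
    (hstep : ∀ n N, n ≤ N → ∀ A, MeasurableSet[ℱ n] A →
      ‖(∫ ω in A, g N ω ∂P) - ∫ ω in A, g n ω ∂P‖ ≤ r n * P.real A)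
    {ε : ℝ} (hε : 0 < ε) : ∃ N, ∀ n, N ≤ n → ∫ ω, ‖g (n + 1) ω - g n ω‖ ∂P < ε := by
  have hg : ∀ n, Integrable (g n) P := fun n =>
    Integrable.of_bound ((hgm n).mono (ℱ.le n)).aestronglyMeasurable C
      (Eventually.of_forall (hC n))
  obtain ⟨F, hF, hFA⟩ := hK.exists_tendsto_setIntegral hKc hKconv hg hC hgK
    fun A hA => cauchySeq_setIntegral_of_filtration ℱ hℱ hg hC hr hstep hA
  obtain ⟨k, G, hG₁, hG₂, hG₃, hG₄⟩ :=
    exists_finite_range_approx_of_filtration ℱ hℱ hF (ε / 4) (by positivity)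
  obtain ⟨N, hN⟩ := eventually_atTop.1
    ((hr.eventually (gt_mem_nhds (show (0 : ℝ) < ε / 4 by positivity))).and
    (eventually_ge_atTop k))
  -- For `n ≥ k` the difference `g n - G` is a simple function known at time `n`, so it suffices to
  -- bound its integrals over sets of `ℱ n`. Letting the later time tend to infinity in `hstep`
  -- compares `g n` with `F` there.
  have key : ∀ n, N ≤ n → ∫ ω, ‖g n ω - G ω‖ ∂P < ε / 2 := by
    intro n hn
    obtain ⟨hrn, hkn⟩ := hN n hn
    have hle : ∫ ω, ‖g n ω - G ω‖ ∂P ≤ ∫ ω, ‖F ω - G ω‖ + r n ∂P := by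
      refine integral_norm_le_of_finite_range (v := fun ω => g n ω - G ω) (ℱ.le n) ((hgm n).sub (hG₁.mono (ℱ.mono hkn)))
        ?_ ((hF.sub hG₃).norm.add (integrable_const _)) fun A hA => ?_
      · refine ((hgfin n).image2 (· - ·) hG₂).subset ?_
        rintro _ ⟨ω, rfl⟩
        exact ⟨_, mem_range_self ω, _, mem_range_self ω, rfl⟩
      · have hA' := ℱ.le n A hA
        have h₁ : ‖(∫ ω in A, F ω ∂P) - ∫ ω in A, g n ω ∂P‖ ≤ r n * P.real A :=
          le_of_tendsto ((hFA A hA').sub_const _).norm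
            ((eventually_ge_atTop n).mono fun N hN => hstep n N hN A hA)
        have hsum : ∫ ω in A, ‖F ω - G ω‖ + r n ∂P =
            (∫ ω in A, ‖F ω - G ω‖ ∂P) + ∫ ω in A, r n ∂P :=
          integral_add (hF.sub hG₃).norm.integrableOn (integrable_const _)
        rw [integral_sub (hg n).integrableOn hG₃.integrableOn, hsum]
        have h₂ : ‖(∫ ω in A, F ω ∂P) - ∫ ω in A, G ω ∂P‖ ≤ ∫ ω in A, ‖F ω - G ω‖ ∂P := by
          rw [← integral_sub hF.integrableOn hG₃.integrableOn]
          exact norm_integral_le_integral_norm _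
        have h₃ := norm_sub_le_norm_sub_add_norm_sub (∫ ω in A, g n ω ∂P) (∫ ω in A, F ω ∂P)
          (∫ ω in A, G ω ∂P)
        rw [norm_sub_rev (∫ ω in A, g n ω ∂P) (∫ ω in A, F ω ∂P)] at h₃
        have h₄ : ∫ ω in A, r n ∂P = r n * P.real A := by simp [mul_comm]
        rw [h₄]
        linarith
    have hsum : ∫ ω, ‖F ω - G ω‖ + r n ∂P = (∫ ω, ‖F ω - G ω‖ ∂P) + ∫ _, r n ∂P :=
      integral_add (hF.sub hG₃).norm (integrable_const _)
    simp only [integral_const, probReal_univ, one_smul] at hsum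
    linarith
  refine ⟨N, fun n hn => ?_⟩
  have h₁ := key n hn
  have h₂ := key (n + 1) (by omega)
  calc ∫ ω, ‖g (n + 1) ω - g n ω‖ ∂P ≤ ∫ ω, ‖g (n + 1) ω - G ω‖ + ‖g n ω - G ω‖ ∂P :=
        integral_mono ((hg _).sub (hg n)).norm (((hg _).sub hG₃).norm.add ((hg n).sub hG₃).norm)
          fun ω => by
            have := norm_sub_le_norm_sub_add_norm_sub (g (n + 1) ω) (G ω) (g n ω)
            rwa [norm_sub_rev (G ω)] at this
    _ = _ := integral_add ((hg _).sub hG₃).norm ((hg n).sub hG₃).norm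
    _ < ε := by linarith

end QuasiMartingale

/-! ### Adding a functional to a strong Radon–Nikodým operator -/

section Functional

open Filter Topology Set

variable {X : Type*} [NormedAddCommGroup X] [NormedSpace ℝ X]
  {Y : Type*} [NormedAddCommGroup Y] [NormedSpace ℝ Y] [CompleteSpace Y]

/-- A density is found coordinatewise: the first coordinate has averages in the closure of the image
of the ball under `T`, and the second is a signed measure, covered by the classical Radon–Nikodým
theorem. -/
theorem IsStrongRadonNikodym.formalSum_functional {T : X →L[ℝ] Y} (hT : IsStrongRadonNikodym T)
    (f : X →L[ℝ] ℝ) : IsStrongRadonNikodym (formalSum T f) := by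
  intro Ω _ P _ m hm0 hmK
  let e := WithLp.prodContinuousLinearEquiv 1 ℝ Y ℝ
  let p₁ : WithLp 1 (Y × ℝ) →L[ℝ] Y := (ContinuousLinearMap.fst ℝ Y ℝ).comp e.toContinuousLinearMap
  let p₂ : WithLp 1 (Y × ℝ) →L[ℝ] ℝ := (ContinuousLinearMap.snd ℝ Y ℝ).comp e.toContinuousLinearMap
  let m₁ : VectorMeasure Ω Y := m.mapRange ((p₁ : WithLp 1 (Y × ℝ) →ₗ[ℝ] Y) : WithLp 1 (Y × ℝ) →+ Y) p₁.continuous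
  let m₂ : SignedMeasure Ω := m.mapRange ((p₂ : WithLp 1 (Y × ℝ) →ₗ[ℝ] ℝ) : WithLp 1 (Y × ℝ) →+ ℝ) p₂.continuous
  have hm₁ : ∀ A, m₁ A = p₁ (m A) := fun A => rfl
  have hm₂ : ∀ A, m₂ A = p₂ (m A) := fun A => rfl
  obtain ⟨F₁, hF₁, hF₁m⟩ := hT Ω P m₁ (fun A hA h => by rw [hm₁, hm0 A hA h, map_zero])
    (fun A hA h => by
      rw [hm₁, ← map_smul]
      refine map_mem_closure p₁.continuous (hmK A hA h) ?_
      rintro _ ⟨x, hx, rfl⟩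
      exact ⟨x, hx, rfl⟩)
  have hac : m₂ ≪ᵥ P.toENNRealVectorMeasure := by
    refine VectorMeasure.AbsolutelyContinuous.mk fun A hA h => ?_
    rw [Measure.toENNRealVectorMeasure_apply_measurable hA] at h
    rw [hm₂, hm0 A hA h, map_zero]
  have hF₂ : Integrable (m₂.rnDeriv P) P := SignedMeasure.integrable_rnDeriv m₂ P
  have hF₂m : ∀ A, MeasurableSet A → m₂ A = ∫ ω in A, m₂.rnDeriv P ω ∂P := fun A hA => by
    rw [← withDensityᵥ_apply hF₂ hA,
      (SignedMeasure.absolutelyContinuous_iff_withDensityᵥ_rnDeriv_eq m₂ P).1 hac]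
  refine ⟨fun ω => e.symm (F₁ ω, m₂.rnDeriv P ω),
    e.symm.toContinuousLinearMap.integrable_comp (hF₁.prodMk hF₂), fun A hA => e.injective ?_⟩
  have h := e.symm.toContinuousLinearMap.integral_comp_comm
    (hF₁.prodMk hF₂).integrableOn (μ := P.restrict A)
  change _ = e (∫ ω in A, e.symm.toContinuousLinearMap (F₁ ω, m₂.rnDeriv P ω) ∂P)
  rw [h, integral_pair hF₁.integrableOn hF₂.integrableOn, ← hF₁m A hA, ← hF₂m A hA]
  exact (e.apply_symm_apply _).symm

end Functional

/-! ### A random walk driven by independent uniform variables -/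

section RandomTree

open Filter Topology Set

open ProbabilityTheory unitInterval

variable {X : Type*} [NormedAddCommGroup X]

/-- The weights of a nearby convex combination form a finite probability law, which is the law of
some function on the unit interval. -/
theorem exists_finite_range_integral_near [NormedSpace ℝ X] [CompleteSpace X] {D : Set X} {b : X}
    (hb : b ∈ closure (convexHull ℝ D)) {η : ℝ} (hη : 0 < η) :
    ∃ φ : I → X, StronglyMeasurable φ ∧ (range φ).Finite ∧ (∀ u, φ u ∈ D) ∧
      ‖(∫ u, φ u) - b‖ ≤ η := by
  obtain ⟨x, hx, hbx⟩ := Metric.mem_closure_iff.1 hb η hη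
  obtain ⟨ι, _, w, z, hw₀, hw₁, hz, rfl⟩ := mem_convexHull_iff_exists_fintype.1 hx
  let _ : MeasurableSpace ι := ⊤
  have : DiscreteMeasurableSpace ι := ⟨fun _ => trivial⟩
  have hne : Nonempty ι := by
    by_contra h
    rw [not_nonempty_iff] at h
    simp at hw₁
  let p : PMF ι := PMF.ofFintype (fun i => ENNReal.ofReal (w i)) (by
    rw [← ENNReal.ofReal_sum_of_nonneg fun i _ => hw₀ i, hw₁, ENNReal.ofReal_one])
  obtain ⟨f, hf, hfp⟩ := p.toMeasure.exists_measurable_map_eq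
  have hz' : StronglyMeasurable z := .of_discrete
  refine ⟨z ∘ f, hz'.comp_measurable hf, (finite_range z).subset (range_comp_subset_range f z),
    fun u => hz _, ?_⟩
  have hint : ∫ u, (z ∘ f) u = ∑ i, w i • z i := by
    simp only [Function.comp_apply]
    rw [← integral_map (φ := f) hf.aemeasurable hz'.aestronglyMeasurable, hfp,
      integral_fintype Integrable.of_finite]
    refine Finset.sum_congr rfl fun i _ => ?_
    rw [measureReal_def, PMF.toMeasure_apply_singleton _ _ (measurableSet_singleton i)]
    simp [p, hw₀ i]
  rw [hint, norm_sub_rev, ← dist_eq_norm]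
  exact hbx.le

/-- The σ-algebra generated by the coordinates before time `n`. -/
def coordFiltration : Filtration ℕ (inferInstance : MeasurableSpace (ℕ → I)) where
  seq n := ⨆ i ∈ Iio n, MeasurableSpace.comap (fun ω : ℕ → I => ω i) inferInstance
  mono' _ _ h := biSup_mono fun _ hi => lt_of_lt_of_le hi h
  le' _ := iSup₂_le fun i _ => (measurable_pi_apply i).comap_le

theorem comap_eval_le_coordFiltration {i n : ℕ} (h : i < n) :
    MeasurableSpace.comap (fun ω : ℕ → I => ω i) inferInstance ≤ coordFiltration n :=
  le_iSup₂_of_le (f := fun i (_ : i ∈ Iio n) =>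
    MeasurableSpace.comap (fun ω : ℕ → I => ω i) inferInstance) i h le_rfl

theorem iSup_coordFiltration :
    ⨆ n, coordFiltration n = (inferInstance : MeasurableSpace (ℕ → I)) := by
  refine le_antisymm (iSup_le coordFiltration.le) ?_
  exact iSup_le fun i => (comap_eval_le_coordFiltration (Nat.lt_succ_self i)).trans
    (le_iSup (fun n => (coordFiltration n : MeasurableSpace (ℕ → I))) (i + 1))

/-- The law of a sequence of independent uniform random variables. -/
noncomputable def uniformSeq : Measure (ℕ → I) := Measure.infinitePi fun _ => volume

instance : IsProbabilityMeasure uniformSeq := by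
  unfold uniformSeq; infer_instance

theorem indep_eval_coordFiltration (n : ℕ) :
    Indep (MeasurableSpace.comap (fun ω : ℕ → I => ω n) inferInstance) (coordFiltration n)
      uniformSeq := by
  have h : iIndepFun (fun (i : ℕ) (ω : ℕ → I) => ω i) uniformSeq :=
    iIndepFun_infinitePi (P := fun _ : ℕ => (volume : Measure I)) (X := fun _ u => u)
      fun _ => measurable_id
  have := indep_iSup_of_disjoint (fun i => (measurable_pi_apply i).comap_le) h.iIndep
    (S := {n}) (T := Iio n) (by simp)
  rw [iSup_singleton] at this
  exact this

/-- Time `n` sees only the coordinates before `n`, so the `n`-th coordinate is independent of `A`.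
-/
theorem setIntegral_comp_eval [NormedSpace ℝ X] [CompleteSpace X] {φ : I → X} (hφ : StronglyMeasurable φ)
    (hfin : (range φ).Finite) (n : ℕ) {A : Set (ℕ → I)} (hA : MeasurableSet[coordFiltration n] A) :
    ∫ ω in A, φ (ω n) ∂uniformSeq = uniformSeq.real A • ∫ u, φ u := by
  have hm : Measurable fun ω : ℕ → I => ω n := measurable_pi_apply n
  have hint : Integrable (fun ω : ℕ → I => φ (ω n)) uniformSeq := by
    obtain ⟨C, hC⟩ := hfin.isBounded.exists_norm_le
    exact Integrable.of_bound (hφ.comp_measurable hm).aestronglyMeasurable C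
      (Eventually.of_forall fun ω => hC _ (mem_range_self _))
  have hsm : StronglyMeasurable[MeasurableSpace.comap (fun ω : ℕ → I => ω n) inferInstance]
      fun ω : ℕ → I => φ (ω n) := hφ.comp_measurable (comap_measurable _)
  have hc := condExp_indep_eq hm.comap_le (coordFiltration.le n) hsm
    (indep_eval_coordFiltration n)
  rw [← setIntegral_condExp (coordFiltration.le n) hint hA,
    setIntegral_congr_ae (g := fun _ => ∫ ω, φ (ω n) ∂uniformSeq) (coordFiltration.le n A hA)
      (hc.mono fun ω h _ => h), setIntegral_const]
  congr 1
  have hmap : uniformSeq.map (fun ω : ℕ → I => ω n) = volume :=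
    Measure.infinitePi_map_eval (fun _ : ℕ => (volume : Measure I)) n
  conv_rhs => rw [← hmap]
  exact (integral_map hm.aemeasurable hφ.aestronglyMeasurable).symm

/-- The random walk started at `b` which moves from `x` to `φ n x u` at time `n`, where `u` is the
`n`-th coordinate. -/
def randomTree (φ : ℕ → X → I → X) (b : X) : ℕ → (ℕ → I) → X
  | 0, _ => b
  | n + 1, ω => φ n (randomTree φ b n ω) (ω n)

variable {φ : ℕ → X → I → X} {b : X}

theorem finite_range_randomTree {X : Type*} {φ : ℕ → X → I → X} {b : X}
    (hfin : ∀ n x, (range (φ n x)).Finite) (n : ℕ) :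
    (range (randomTree φ b n)).Finite := by
  induction n with
  | zero => exact (finite_singleton b).subset (by rintro _ ⟨ω, rfl⟩; rfl)
  | succ n ih =>
    refine (ih.biUnion fun x _ => hfin n x).subset ?_
    rintro _ ⟨ω, rfl⟩
    exact mem_biUnion (mem_range_self ω) (mem_range_self (ω n))

theorem stronglyMeasurable_randomTree (hφ : ∀ n x, StronglyMeasurable (φ n x))
    (hfin : ∀ n x, (range (φ n x)).Finite) (n : ℕ) :
    StronglyMeasurable[coordFiltration n] (randomTree φ b n) := by
  classical
  induction n with
  | zero => exact @stronglyMeasurable_const _ _ (coordFiltration 0) _ b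
  | succ n ih =>
    have hR := finite_range_randomTree (φ := φ) (b := b) hfin n
    -- No measurability of `φ n x u` in `x` is assumed; since the walk takes finitely many values,
    -- it can be split along them.
    have heq : randomTree φ b (n + 1) = fun ω => ∑ x ∈ hR.toFinset,
        (randomTree φ b n ⁻¹' {x}).indicator (fun ω => φ n x (ω n)) ω := by
      ext ω
      rw [Finset.sum_eq_single (randomTree φ b n ω)]
      · simp [randomTree]
      · intro x _ hx
        exact indicator_of_notMem (by simpa using hx.symm) _
      · intro h
        simp at h
    rw [heq]
    refine Finset.stronglyMeasurable_fun_sum _ fun x _ => StronglyMeasurable.indicator ?_ ?_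
    · exact (hφ n x).comp_measurable ((comap_measurable _).mono
        (comap_eval_le_coordFiltration (Nat.lt_succ_self n)) le_rfl)
    · refine coordFiltration.mono (Nat.le_succ n) _ ?_
      borelize X
      exact @StronglyMeasurable.measurable _ _ _ (coordFiltration n) _ _ _ _ ih _
        (measurableSet_singleton x)

theorem integrable_randomTree (hφ : ∀ n x, StronglyMeasurable (φ n x))
    (hfin : ∀ n x, (range (φ n x)).Finite) (n : ℕ) :
    Integrable (randomTree φ b n) uniformSeq := by
  obtain ⟨C, hC⟩ := (finite_range_randomTree (b := b) hfin n).isBounded.exists_norm_le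
  exact Integrable.of_bound ((stronglyMeasurable_randomTree hφ hfin n).mono
    (coordFiltration.le n)).aestronglyMeasurable C
      (Eventually.of_forall fun ω => hC _ (mem_range_self _))

variable [NormedSpace ℝ X]

/-- On the part of `A` where the walk sits at `x`, independence makes the integral of the increment
equal to the measure of that part times `(∫ u, φ n x u) - x`. -/
theorem norm_setIntegral_randomTree_succ_sub_le [CompleteSpace X]
    (hφ : ∀ n x, StronglyMeasurable (φ n x))
    (hfin : ∀ n x, (range (φ n x)).Finite) {n : ℕ} {η : ℝ}
    (hη : ∀ ω, ‖(∫ u, φ n (randomTree φ b n ω) u) - randomTree φ b n ω‖ ≤ η)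
    {A : Set (ℕ → I)} (hA : MeasurableSet[coordFiltration n] A) :
    ‖(∫ ω in A, randomTree φ b (n + 1) ω ∂uniformSeq) - ∫ ω in A, randomTree φ b n ω ∂uniformSeq‖
      ≤ η * uniformSeq.real A := by
  have hR := finite_range_randomTree (φ := φ) (b := b) hfin n
  have hAx : ∀ x, MeasurableSet[coordFiltration n] (A ∩ randomTree φ b n ⁻¹' {x}) := fun x => by
    refine hA.inter ?_
    borelize X
    exact @StronglyMeasurable.measurable _ _ _ (coordFiltration n) _ _ _ _
      (stronglyMeasurable_randomTree hφ hfin n) _ (measurableSet_singleton x)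
  have hAx' := fun x => coordFiltration.le n _ (hAx x)
  have hU : A = ⋃ x ∈ hR.toFinset, A ∩ randomTree φ b n ⁻¹' {x} := by
    ext ω; simp
  have hdisj : (hR.toFinset : Set X).Pairwise
      (Function.onFun Disjoint fun x => A ∩ randomTree φ b n ⁻¹' {x}) := by
    intro y _ z _ hyz
    exact (Disjoint.preimage _ (by simpa using hyz)).mono inter_subset_right inter_subset_right
  have hsplit : ∀ f : (ℕ → I) → X, Integrable f uniformSeq → ∫ ω in A, f ω ∂uniformSeq =
      ∑ x ∈ hR.toFinset, ∫ ω in A ∩ randomTree φ b n ⁻¹' {x}, f ω ∂uniformSeq := by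
    intro f hf
    conv_lhs => rw [hU]
    exact integral_biUnion_finset _ (fun y _ => hAx' y) hdisj (fun y _ => hf.integrableOn)
  have hmeas : uniformSeq.real A =
      ∑ x ∈ hR.toFinset, uniformSeq.real (A ∩ randomTree φ b n ⁻¹' {x}) := by
    conv_lhs => rw [hU]
    exact measureReal_biUnion_finset hdisj fun x _ => hAx' x
  rw [hsplit _ (integrable_randomTree hφ hfin _), hsplit _ (integrable_randomTree hφ hfin _),
    ← Finset.sum_sub_distrib, hmeas, Finset.mul_sum]
  refine norm_sum_le_of_le _ fun x hx => ?_
  obtain ⟨ω₀, rfl⟩ : x ∈ range (randomTree φ b n) := by simpa using hx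
  set x := randomTree φ b n ω₀ with hx_def
  rw [setIntegral_congr_fun (f := randomTree φ b (n + 1)) (g := fun ω => φ n x (ω n)) (hAx' x)
      (fun ω hω => by
        have : randomTree φ b n ω = x := hω.2
        simp only [randomTree, this]),
    setIntegral_comp_eval (hφ n x) (hfin n x) n (hAx x),
    setIntegral_congr_fun (f := randomTree φ b n) (g := fun _ => x) (hAx' x) (fun ω hω => hω.2),
    setIntegral_const, ← smul_sub, norm_smul, Real.norm_eq_abs,
    abs_of_nonneg measureReal_nonneg, mul_comm]
  exact mul_le_mul_of_nonneg_right (hη ω₀) measureReal_nonneg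

theorem norm_setIntegral_randomTree_sub_le [CompleteSpace X]
    (hφ : ∀ n x, StronglyMeasurable (φ n x))
    (hfin : ∀ n x, (range (φ n x)).Finite) {c : ℝ} (hc : 0 ≤ c)
    (hη : ∀ n ω, ‖(∫ u, φ n (randomTree φ b n ω) u) - randomTree φ b n ω‖ ≤ c * (1 / 2) ^ n)
    {n N : ℕ} (hnN : n ≤ N) {A : Set (ℕ → I)} (hA : MeasurableSet[coordFiltration n] A) :
    ‖(∫ ω in A, randomTree φ b N ω ∂uniformSeq) - ∫ ω in A, randomTree φ b n ω ∂uniformSeq‖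
      ≤ 2 * c * (1 / 2) ^ n * uniformSeq.real A := by
  -- The bound is kept as a difference of geometric tails, so that the one-step errors telescope.
  have key : ‖(∫ ω in A, randomTree φ b N ω ∂uniformSeq) -
      ∫ ω in A, randomTree φ b n ω ∂uniformSeq‖
      ≤ (2 * c * (1 / 2) ^ n - 2 * c * (1 / 2) ^ N) * uniformSeq.real A := by
    induction N, hnN using Nat.le_induction with
    | base => simp
    | succ N hN ih =>
      have h := norm_setIntegral_randomTree_succ_sub_le hφ hfin (hη N)
        (coordFiltration.mono hN _ hA)
      have h' := norm_sub_le_norm_sub_add_norm_sub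
        (∫ ω in A, randomTree φ b (N + 1) ω ∂uniformSeq)
        (∫ ω in A, randomTree φ b N ω ∂uniformSeq) (∫ ω in A, randomTree φ b n ω ∂uniformSeq)
      refine h'.trans ((add_le_add h ih).trans (le_of_eq ?_))
      ring
  refine key.trans (mul_le_mul_of_nonneg_right ?_ measureReal_nonneg)
  have : 0 ≤ 2 * c * (1 / 2) ^ N := by positivity
  linarith

end RandomTree

/-! ### Slices with small image -/

section SmallSlice

open Filter Topology Set

open unitInterval

variable {X : Type*} [NormedAddCommGroup X] [NormedSpace ℝ X]
  {Y : Type*} [NormedAddCommGroup Y] [NormedSpace ℝ Y]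

theorem exists_slice_of_notMem_closure_convexHull {D : Set X} {b : X}
    (hb : b ∉ closure (convexHull ℝ D)) :
    ∃ (g : X →L[ℝ] ℝ) (β : ℝ), β < g b ∧ ∀ x ∈ D, g x < β := by
  obtain ⟨g, β, h₁, h₂⟩ := geometric_hahn_banach_closed_point
    (convex_convexHull ℝ D).closure isClosed_closure hb
  exact ⟨g, β, h₂, fun x hx => h₁ x (subset_closure (subset_convexHull ℝ D hx))⟩

theorem exists_norm_le_one_lt_apply (h : X →L[ℝ] ℝ) {r : ℝ} (hr : r < ‖h‖) :
    ∃ b, ‖b‖ ≤ 1 ∧ r < h b := by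
  obtain ⟨x, hx, hrx⟩ := h.exists_lt_apply_of_lt_opNorm hr
  rcases le_total 0 (h x) with h0 | h0
  · exact ⟨x, hx.le, by rwa [Real.norm_of_nonneg h0] at hrx⟩
  · exact ⟨-x, by rw [norm_neg]; exact hx.le, by
      rwa [Real.norm_of_nonpos h0, ← map_neg] at hrx⟩

theorem apply_le_opNorm_of_norm_le_one (h : X →L[ℝ] ℝ) {b : X} (hb : ‖b‖ ≤ 1) : h b ≤ ‖h‖ :=
  (le_abs_self _).trans ((h.le_opNorm b).trans
    (mul_le_of_le_one_right (norm_nonneg _) hb))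

/-- If `T` is a strong Radon–Nikodým operator, every slice `{h > α}` of the unit ball contains a
slice whose image under `T` is small. -/
theorem IsStrongRadonNikodym.exists_small_slice [CompleteSpace X] [CompleteSpace Y]
    {T : X →L[ℝ] Y}
    (hT : IsStrongRadonNikodym T) (h : X →L[ℝ] ℝ) {α : ℝ} (hα : α < ‖h‖) {δ : ℝ} (hδ : 0 < δ) :
    ∃ (g : X →L[ℝ] ℝ) (β : ℝ) (b : X), ‖b‖ ≤ 1 ∧ β < g b ∧
      ∀ x, ‖x‖ ≤ 1 → β < g x → α < h x ∧ ‖T x - T b‖ < δ := by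
  classical
  by_contra hcon
  push Not at hcon
  have hmem : ∀ b, ‖b‖ ≤ 1 →
      b ∈ closure (convexHull ℝ {x : X | ‖x‖ ≤ 1 ∧ (α < h x → δ ≤ ‖T x - T b‖)}) := by
    intro b hb
    by_contra hb'
    obtain ⟨g, β, h₁, h₂⟩ := exists_slice_of_notMem_closure_convexHull hb'
    obtain ⟨x, hx, hβ, hx'⟩ := hcon g β b hb h₁
    exact (h₂ x ⟨hx, hx'⟩).not_gt hβ
  -- The one-step errors `c * (1 / 2) ^ n` add up to at most `2 * c`, which changes the mean of `h`
  -- by at most `(‖h‖ - α) / 4`.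
  set c : ℝ := (‖h‖ - α) / (8 * (‖h‖ + 1)) with hc_def
  have hc : 0 < c := div_pos (by linarith) (by positivity)
  have hstep : ∀ (n : ℕ) (b : X), ∃ φ : I → X, StronglyMeasurable φ ∧ (range φ).Finite ∧
      (‖b‖ ≤ 1 → (∀ u, ‖φ u‖ ≤ 1 ∧ (α < h (φ u) → δ ≤ ‖T (φ u) - T b‖)) ∧
        ‖(∫ u, φ u) - b‖ ≤ c * (1 / 2) ^ n) ∧ (h b ≤ α → ∀ u, φ u = b) := by
    intro n b
    have hpos : 0 < c * (1 / 2) ^ n := by positivity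
    by_cases hb : ‖b‖ ≤ 1 ∧ α < h b
    · obtain ⟨φ, h₁, h₂, h₃, h₄⟩ := exists_finite_range_integral_near (hmem b hb.1) hpos
      exact ⟨φ, h₁, h₂, fun _ => ⟨h₃, h₄⟩, fun h' => absurd hb.2 h'.not_gt⟩
    · refine ⟨fun _ => b, stronglyMeasurable_const,
        (finite_singleton b).subset (by rintro _ ⟨_, rfl⟩; rfl), fun hb' => ⟨fun _ =>
        ⟨hb', fun h' => absurd ⟨hb', h'⟩ hb⟩, ?_⟩, fun _ _ => rfl⟩
      simpa using hpos.le
  choose φ hφ hfin hφ₁ hφ₂ using hstep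
  obtain ⟨b, hb, hhb⟩ := exists_norm_le_one_lt_apply h
    (show ‖h‖ - (‖h‖ - α) / 4 < ‖h‖ by linarith)
  have hS : ∀ n ω, ‖randomTree φ b n ω‖ ≤ 1 := by
    intro n ω
    induction n with
    | zero => exact hb
    | succ n ih => exact ((hφ₁ n _ ih).1 _).1
  have hη : ∀ n ω, ‖(∫ u, φ n (randomTree φ b n ω) u) - randomTree φ b n ω‖ ≤ c * (1 / 2) ^ n :=
    fun n ω => (hφ₁ n _ (hS n ω)).2
  have hint := fun n => integrable_randomTree (b := b) hφ hfin n
  have hstepS := fun n N (hnN : n ≤ N) A hA =>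
    norm_setIntegral_randomTree_sub_le (b := b) hφ hfin hc.le hη (n := n) (N := N) hnN (A := A) hA
  have hTint : ∀ n (A : Set (ℕ → I)), ∫ ω in A, T (randomTree φ b n ω) ∂uniformSeq =
      T (∫ ω in A, randomTree φ b n ω ∂uniformSeq) := fun n A =>
    T.integral_comp_comm (hint n).integrableOn
  have hr : Tendsto (fun n : ℕ => ‖T‖ * (2 * c * (1 / 2) ^ n)) atTop (𝓝 0) := by
    have := (tendsto_pow_atTop_nhds_zero_of_lt_one (r := (1 / 2 : ℝ)) (by norm_num)
      (by norm_num)).const_mul (2 * c) |>.const_mul ‖T‖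
    simpa using this
  obtain ⟨N, hN⟩ := HasRadonNikodymProperty.exists_integral_norm_sub_lt (P := uniformSeq) hT
    isClosed_closure
    (((convex_closedBall (0 : X) 1).linear_image (T : X →ₗ[ℝ] Y)).closure)
    coordFiltration iSup_coordFiltration
    (g := fun n ω => T (randomTree φ b n ω)) (C := ‖T‖)
    (fun n => T.continuous.comp_stronglyMeasurable (stronglyMeasurable_randomTree hφ hfin n))
    (fun n => ((finite_range_randomTree (b := b) hfin n).image T).subset
      (by rintro _ ⟨ω, rfl⟩; exact ⟨_, mem_range_self ω, rfl⟩))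
    (fun n ω => (T.le_opNorm _).trans (mul_le_of_le_one_right (norm_nonneg _) (hS n ω)))
    (fun n ω => subset_closure ⟨_, by simpa using hS n ω, rfl⟩)
    hr
    (fun n N hnN A hA => by
      rw [hTint, hTint, ← map_sub, mul_assoc]
      exact (T.le_opNorm _).trans
        (mul_le_mul_of_nonneg_left (hstepS n N hnN A hA) (norm_nonneg _)))
    (half_pos hδ)
  have hlt := hN N le_rfl
  set E : Set (ℕ → I) := {ω | h (randomTree φ b (N + 1) ω) ≤ α} with hE_def
  have hsm := (stronglyMeasurable_randomTree (b := b) hφ hfin (N + 1)).mono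
    (coordFiltration.le (N + 1))
  have hE : MeasurableSet E :=
    (h.continuous.comp_stronglyMeasurable hsm).measurable measurableSet_Iic
  -- The mean of `h` at time `N + 1` exceeds `‖h‖ - (‖h‖ - α) / 2`: one quarter of `‖h‖ - α` is lost
  -- at the start `b`, one to the drift. It is also at most `‖h‖ - (‖h‖ - α) * P(E)`.
  have hPE : uniformSeq.real E ≤ 1 / 2 := by
    have h₁ : h (∫ ω, randomTree φ b (N + 1) ω ∂uniformSeq) =
        ∫ ω, h (randomTree φ b (N + 1) ω) ∂uniformSeq := (h.integral_comp_comm (hint _)).symm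
    have h₂ := hstepS 0 (N + 1) (Nat.zero_le _) univ MeasurableSet.univ
    simp only [Measure.restrict_univ, randomTree, integral_const, probReal_univ, one_smul,
      pow_zero, mul_one] at h₂
    have h₃ : h b - ‖h‖ * (2 * c) ≤ h (∫ ω, randomTree φ b (N + 1) ω ∂uniformSeq) := by
      have := (h.le_opNorm ((∫ ω, randomTree φ b (N + 1) ω ∂uniformSeq) - b)).trans
        (mul_le_mul_of_nonneg_left h₂ (norm_nonneg h))
      rw [map_sub, Real.norm_eq_abs, abs_le] at this
      linarith [this.1]
    have h₄ : ∫ ω, h (randomTree φ b (N + 1) ω) ∂uniformSeq ≤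
        ∫ ω, ‖h‖ - E.indicator (fun _ => ‖h‖ - α) ω ∂uniformSeq := by
      refine integral_mono (h.integrable_comp (hint _))
        ((integrable_const _).sub ((integrable_const _).indicator hE)) fun ω => ?_
      by_cases hω : ω ∈ E
      · have : h (randomTree φ b (N + 1) ω) ≤ α := hω
        simp only [indicator_of_mem hω]
        linarith
      · simpa [hω] using apply_le_opNorm_of_norm_le_one h (hS (N + 1) ω)
    rw [integral_sub (integrable_const _) ((integrable_const _).indicator hE),
      integral_indicator hE] at h₄
    simp only [integral_const, probReal_univ, measureReal_restrict_apply_univ,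
      smul_eq_mul] at h₄
    have h₅ : ‖h‖ * (2 * c) ≤ (‖h‖ - α) / 4 := by
      rw [hc_def]
      have h0 := norm_nonneg h
      have : ‖h‖ * (2 * ((‖h‖ - α) / (8 * (‖h‖ + 1)))) =
        (‖h‖ - α) / 4 * (‖h‖ / (‖h‖ + 1)) := by field_simp; ring
      rw [this]
      exact mul_le_of_le_one_right (by linarith) (div_le_one_of_le₀ (by linarith) (by linarith))
    have hpos : 0 < ‖h‖ - α := by linarith
    by_contra hgt
    push Not at hgt
    nlinarith
  -- Off `E` the last step landed in the slice, so it was a jump of size at least `δ`; the mean jump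
  -- is then at least `δ / 2`, against the choice of `N`.
  have hlow : ∫ ω, Eᶜ.indicator (fun _ => δ) ω ∂uniformSeq ≤
      ∫ ω, ‖T (randomTree φ b (N + 1) ω) - T (randomTree φ b N ω)‖ ∂uniformSeq := by
    refine integral_mono ((integrable_const _).indicator hE.compl)
      ((T.integrable_comp (hint _)).sub (T.integrable_comp (hint _))).norm fun ω => ?_
    by_cases hω : ω ∈ E
    · simp [hω]
    · have hω' : α < h (φ N (randomTree φ b N ω) (ω N)) := not_le.1 hω
      simp only [indicator_of_mem (show ω ∈ Eᶜ from hω)]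
      exact ((hφ₁ N _ (hS N ω)).1 (ω N)).2 hω'
  rw [integral_indicator hE.compl, setIntegral_const, smul_eq_mul,
    probReal_compl_eq_one_sub hE] at hlow
  nlinarith

end SmallSlice

/-! ### Daugavet sets and narrow operators -/

section Daugavet

open Filter Topology Set

variable {X : Type*} [NormedAddCommGroup X] [NormedSpace ℝ X]

/-- A subset `W` of the unit ball such that for all `u` and `c ≥ 0` some `z ∈ W` almost attains
the bound `‖u + c • z‖ ≤ ‖u‖ + c`. -/
def IsDaugavetSet (W : Set X) : Prop :=
  ∀ (u : X) (c : ℝ), 0 ≤ c → ∀ η : ℝ, 0 < η → ∃ z ∈ W, ‖u‖ + c - η ≤ ‖u + c • z‖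

/-- Multiply `x + z` by the larger of the two coefficients and remove the excess by the triangle
inequality. -/
theorem le_norm_smul_add_smul {x z : X} (hx : ‖x‖ = 1) (hz : ‖z‖ ≤ 1) {η : ℝ}
    (h : 2 - η ≤ ‖x + z‖) {r c : ℝ} (hr : 0 ≤ r) (hc : 0 ≤ c) :
    r + c - (r + c) * η ≤ ‖r • x + c • z‖ := by
  have hη : 0 ≤ η := by
    have := norm_add_le x z
    linarith
  rcases le_total c r with hcr | hcr
  · have h₁ : r • (x + z) = (r • x + c • z) + (r - c) • z := by
      rw [smul_add, sub_smul]; abel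
    have h₂ : r * ‖x + z‖ ≤ ‖r • x + c • z‖ + (r - c) * ‖z‖ := by
      rw [← norm_smul_of_nonneg hr, h₁, ← norm_smul_of_nonneg (sub_nonneg.2 hcr)]
      exact norm_add_le _ _
    nlinarith [mul_le_mul_of_nonneg_left h hr, mul_nonneg hc hη,
      mul_le_mul_of_nonneg_left hz (sub_nonneg.2 hcr)]
  · have h₁ : c • (x + z) = (r • x + c • z) + (c - r) • x := by
      rw [smul_add, sub_smul]; abel
    have h₂ : c * ‖x + z‖ ≤ ‖r • x + c • z‖ + (c - r) * ‖x‖ := by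
      rw [← norm_smul_of_nonneg hc, h₁, ← norm_smul_of_nonneg (sub_nonneg.2 hcr)]
      exact norm_add_le _ _
    rw [hx] at h₂
    nlinarith [mul_le_mul_of_nonneg_left h hc, mul_nonneg hr hη]

theorem isDaugavetSet_of_unit [Nontrivial X] {W : Set X} (hW : ∀ z ∈ W, ‖z‖ ≤ 1)
    (h : ∀ x : X, ‖x‖ = 1 → ∀ ε : ℝ, 0 < ε → ∃ z ∈ W, 2 - ε < ‖z + x‖) : IsDaugavetSet W := by
  have key : ∀ (x : X), ‖x‖ = 1 → ∀ r : ℝ, 0 ≤ r → ∀ c : ℝ, 0 ≤ c → ∀ η : ℝ, 0 < η →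
      ∃ z ∈ W, r + c - η ≤ ‖r • x + c • z‖ := by
    intro x hx r hr c hc η hη
    obtain ⟨z, hz, hzx⟩ := h x hx (η / (r + c + 1)) (by positivity)
    refine ⟨z, hz, ?_⟩
    rw [add_comm z x] at hzx
    have h₁ := le_norm_smul_add_smul hx (hW z hz) hzx.le hr hc
    have h₂ : (r + c) * (η / (r + c + 1)) ≤ η := by
      rw [mul_div_assoc', div_le_iff₀ (by positivity)]
      nlinarith
    linarith
  intro u c hc η hη
  by_cases hu : u = 0
  · obtain ⟨x, hx⟩ := exists_norm_eq X (zero_le_one (α := ℝ))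
    simpa [hu] using key x hx 0 le_rfl c hc η hη
  · have hu' : 0 < ‖u‖ := norm_pos_iff.2 hu
    have := key (‖u‖⁻¹ • u) (norm_smul_inv_norm hu) ‖u‖ hu'.le c hc η hη
    rwa [smul_inv_smul₀ hu'.ne'] at this

/-- The `z i` are chosen successively, each against the sum already formed; this is why
`IsDaugavetSet` allows arbitrary `u` and `c`. -/
theorem exists_norm_add_sum_smul_ge {ι : Type*} {W : ι → Set X}
    (hW : ∀ i, IsDaugavetSet (W i)) {w : ι → ℝ} (hw : ∀ i, 0 ≤ w i) (u : X) (s : Finset ι) :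
    ∀ η : ℝ, 0 < η → ∃ z : ι → X, (∀ i, z i ∈ W i) ∧
      ‖u‖ + ∑ i ∈ s, w i - η ≤ ‖u + ∑ i ∈ s, w i • z i‖ := by
  classical
  induction s using Finset.induction_on with
  | empty =>
    intro η hη
    choose z hz using fun i => hW i 0 0 le_rfl 1 one_pos
    exact ⟨z, fun i => (hz i).1, by simpa using hη.le⟩
  | insert a s ha ih =>
    intro η hη
    obtain ⟨z, hz, hzs⟩ := ih (η / 2) (half_pos hη)
    obtain ⟨v, hv, hvs⟩ := hW a (u + ∑ i ∈ s, w i • z i) (w a) (hw a) (η / 2) (half_pos hη)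
    refine ⟨Function.update z a v, fun i => ?_, ?_⟩
    · by_cases hi : i = a
      · subst hi; simpa using hv
      · simpa [hi] using hz i
    · have hsum : ∑ i ∈ s, w i • Function.update z a v i = ∑ i ∈ s, w i • z i :=
        Finset.sum_congr rfl fun i hi => by
          rw [Function.update_of_ne (ne_of_mem_of_not_mem hi ha)]
      rw [Finset.sum_insert ha, Finset.sum_insert ha, hsum, Function.update_self,
        add_comm (w a • v), ← add_assoc u]
      linarith

/-- A vector of the ball with `‖z + x‖` almost `2` has norm almost `1`, so normalizing it costs
little. -/
theorem isStrongDaugavet_of_norm_le_one {Y : Type*} [NormedAddCommGroup Y] [NormedSpace ℝ Y]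
    {T : X →L[ℝ] Y} (h : ∀ x y : X, ‖x‖ = 1 → ‖y‖ = 1 → ∀ ε : ℝ, 0 < ε →
      ∃ z : X, ‖z‖ ≤ 1 ∧ ‖T (z - y)‖ < ε ∧ 2 - ε < ‖z + x‖) : IsStrongDaugavet T := by
  intro x y hx hy ε hε
  set η := min (1 / 2) (ε / (2 + ‖T‖)) with hη_def
  have hη : 0 < η := lt_min (by norm_num) (by positivity)
  have hη₁ : η ≤ 1 / 2 := min_le_left _ _
  have hη₂ : (2 + ‖T‖) * η ≤ ε := by
    have := min_le_right (1 / 2) (ε / (2 + ‖T‖))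
    rwa [← hη_def, le_div_iff₀ (by positivity), mul_comm] at this
  obtain ⟨z, hz, hTz, hzx⟩ := h x y hx hy η hη
  have hz' : 1 - η < ‖z‖ := by
    have := norm_add_le z x
    linarith
  have hz0 : 0 < ‖z‖ := by linarith
  have hdist : ‖‖z‖⁻¹ • z - z‖ ≤ η := by
    have : ‖z‖⁻¹ • z - z = (1 - ‖z‖) • ‖z‖⁻¹ • z := by
      rw [sub_smul, one_smul, smul_inv_smul₀ hz0.ne']
    rw [this, norm_smul, norm_smul_of_nonneg (by positivity), inv_mul_cancel₀ hz0.ne', mul_one,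
      Real.norm_of_nonneg (by linarith)]
    linarith
  have hT := norm_nonneg T
  refine ⟨‖z‖⁻¹ • z, norm_smul_inv_norm (norm_pos_iff.1 hz0), ?_, ?_⟩
  · have h₁ : ‖z‖⁻¹ • z - y = (‖z‖⁻¹ • z - z) + (z - y) := by abel
    rw [h₁, map_add]
    refine (norm_add_le _ _).trans_lt ?_
    have := (T.le_opNorm (‖z‖⁻¹ • z - z)).trans (mul_le_mul_of_nonneg_left hdist hT)
    nlinarith
  · have h₁ := norm_add_le (‖z‖⁻¹ • z + x) (-(‖z‖⁻¹ • z - z))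
    have h₂ : (‖z‖⁻¹ • z + x) + (-(‖z‖⁻¹ • z - z)) = z + x := by abel
    rw [h₂, norm_neg] at h₁
    nlinarith

theorem exists_unit_in_slice [Nontrivial X] {g : X →L[ℝ] ℝ} {β : ℝ} {b : X} (hb : ‖b‖ ≤ 1)
    (hβ : β < g b) : ∃ y : X, ‖y‖ = 1 ∧ β < g y := by
  rcases lt_trichotomy (g b) 0 with h | h | h
  · have hb0 : b ≠ 0 := by rintro rfl; simp at h
    refine ⟨‖b‖⁻¹ • (-b), by rw [smul_neg, norm_neg]; exact norm_smul_inv_norm hb0, ?_⟩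
    rw [map_smul, map_neg, smul_eq_mul]
    have : 0 ≤ ‖b‖⁻¹ * -g b := mul_nonneg (by positivity) (by linarith)
    linarith
  · obtain ⟨x, hx⟩ := exists_norm_eq X (zero_le_one (α := ℝ))
    rcases le_total 0 (g x) with h' | h'
    · exact ⟨x, hx, by linarith⟩
    · exact ⟨-x, by rwa [norm_neg], by rw [map_neg]; linarith⟩
  · have hb0 : b ≠ 0 := by rintro rfl; simp at h
    refine ⟨‖b‖⁻¹ • b, norm_smul_inv_norm hb0, ?_⟩
    rw [map_smul, smul_eq_mul]
    have : 1 ≤ ‖b‖⁻¹ := (one_le_inv₀ (norm_pos_iff.2 hb0)).2 hb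
    nlinarith

variable {Y : Type*} [NormedAddCommGroup Y] [NormedSpace ℝ Y]

/-- Adding `g` to `T` keeps `g z` within `g y - β` of `g y`, so `z` stays in the slice. -/
theorem IsNarrow.isDaugavetSet [Nontrivial X] {T : X →L[ℝ] Y} (hT : IsNarrow T) {y : X}
    (hy : ‖y‖ = 1) {g : X →L[ℝ] ℝ} {β : ℝ} (hβ : β < g y) {η : ℝ} (hη : 0 < η) :
    IsDaugavetSet {z : X | ‖z‖ ≤ 1 ∧ β < g z ∧ ‖T (z - y)‖ < η} := by
  refine isDaugavetSet_of_unit (fun z hz => hz.1) fun x hx ε hε => ?_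
  obtain ⟨z, hz, hTz, hzx⟩ := hT g x y hx hy (min ε (min η (g y - β)))
    (lt_min hε (lt_min hη (by linarith)))
  rw [norm_formalSum_apply, lt_min_iff, lt_min_iff] at hTz
  have h₁ := norm_nonneg (T (z - y))
  have h₂ := norm_nonneg (g (z - y))
  have h₃ := neg_abs_le (g (z - y))
  rw [← Real.norm_eq_abs] at h₃
  have h₄ : g (z - y) = g z - g y := map_sub _ _ _
  refine ⟨z, ⟨hz.le, by linarith, by linarith⟩, ?_⟩
  have := min_le_left ε (min η (g y - β))
  linarith

/-- The unit sphere is contained in the closed convex hull of the unit vectors lying in a slice of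
the unit ball with small image. -/
theorem IsStrongRadonNikodym.mem_closure_convexHull [Nontrivial X] [CompleteSpace X]
    [CompleteSpace Y] {T : X →L[ℝ] Y} (hT : IsStrongRadonNikodym T) {y : X} (hy : ‖y‖ ≤ 1)
    {η : ℝ} (hη : 0 < η) :
    y ∈ closure (convexHull ℝ {d : X | ‖d‖ = 1 ∧ ∃ (g : X →L[ℝ] ℝ) (β : ℝ), β < g d ∧
      ∀ z, ‖z‖ ≤ 1 → β < g z → ‖T z - T d‖ < η}) := by
  by_contra hcon
  -- The separating slice `{h > α}` misses the set, yet contains a small slice, whose unit vectors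
  -- belong to the set. The radius is halved because the centre moves from `b` to `d`.
  obtain ⟨h, α, hα, hD⟩ := exists_slice_of_notMem_closure_convexHull hcon
  obtain ⟨g, β, b, hb, hβ, hsl⟩ := hT.exists_small_slice h
    (hα.trans_le (apply_le_opNorm_of_norm_le_one h hy)) (half_pos hη)
  obtain ⟨d, hd, hβd⟩ := exists_unit_in_slice hb hβ
  refine (hD d ⟨hd, g, β, hβd, fun z hz hzβ => ?_⟩).not_gt (hsl d hd.le hβd).1
  have h₁ := (hsl z hz hzβ).2
  have h₂ := (hsl d hd.le hβd).2
  have h₃ := norm_sub_le_norm_sub_add_norm_sub (T z) (T b) (T d)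
  rw [norm_sub_rev (T b)] at h₃
  linarith

theorem norm_map_sum_smul_sub_le {ι : Type*} [Fintype ι] (T : X →L[ℝ] Y) {w : ι → ℝ}
    (hw₀ : ∀ i, 0 ≤ w i) (hw₁ : ∑ i, w i = 1) {z d : ι → X} {η : ℝ}
    (h : ∀ i, ‖T (z i - d i)‖ ≤ η) : ‖T (∑ i, w i • z i - ∑ i, w i • d i)‖ ≤ η := by
  simp_rw [← Finset.sum_sub_distrib, ← smul_sub, map_sum, map_smul]
  calc ‖∑ i, w i • T (z i - d i)‖ ≤ ∑ i, w i * η := norm_sum_le_of_le _ fun i _ => by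
        rw [norm_smul, Real.norm_of_nonneg (hw₀ i)]
        exact mul_le_mul_of_nonneg_left (h i) (hw₀ i)
    _ = η := by rw [← Finset.sum_mul, hw₁, one_mul]

theorem nontrivial_of_norm_eq_one {X : Type*} [NormedAddCommGroup X] {x : X} (hx : ‖x‖ = 1) : Nontrivial X :=
  ⟨x, 0, fun h => by simp [h] at hx⟩

theorem IsNarrow.formalSum_of_isStrongRadonNikodym [CompleteSpace X] {Y₁ : Type*}
    [NormedAddCommGroup Y₁] [NormedSpace ℝ Y₁] [CompleteSpace Y₁] {T : X →L[ℝ] Y}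
    {T₁ : X →L[ℝ] Y₁} (hT : IsNarrow T) (hT₁ : IsStrongRadonNikodym T₁) :
    IsNarrow (formalSum T T₁) := by
  intro f
  refine isStrongDaugavet_of_norm_le_one fun x y hx hy ε hε => ?_
  have := nontrivial_of_norm_eq_one hx
  set S := formalSum (formalSum T T₁) f with hS
  have hT₂ := hT₁.formalSum_functional f
  set T₂ := formalSum T₁ f with hT₂_def
  have hnorm : ∀ v, ‖S v‖ = ‖T v‖ + ‖T₂ v‖ := fun v => by
    rw [hS, hT₂_def, norm_formalSum_apply, norm_formalSum_apply, norm_formalSum_apply, add_assoc]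
  -- The errors under `S` are `η` from `T`, `η` from `T₂` and `‖S‖ * η` from approximating `y`.
  set η := ε / (3 + ‖S‖) with hη_def
  have hη : 0 < η := by positivity
  have hηε : (3 + ‖S‖) * η = ε := by rw [hη_def]; field_simp
  obtain ⟨d', hd', hyd⟩ := Metric.mem_closure_iff.1 (hT₂.mem_closure_convexHull hy.le hη) η hη
  obtain ⟨ι, _, w, d, hw₀, hw₁, hd, rfl⟩ := mem_convexHull_iff_exists_fintype.1 hd'
  choose hd₁ g β hβ hsl using hd
  obtain ⟨z, hz, hxz⟩ := exists_norm_add_sum_smul_ge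
    (fun i => hT.isDaugavetSet (hd₁ i) (hβ i) hη) hw₀ x Finset.univ η hη
  rw [hx, hw₁] at hxz
  have hS0 := norm_nonneg S
  refine ⟨∑ i, w i • z i, ?_, ?_, ?_⟩
  · have := (convex_closedBall (0 : X) 1).sum_mem (t := Finset.univ) (fun i _ => hw₀ i) hw₁
      (z := z) fun i _ => by simpa using (hz i).1
    simpa using this
  · have h₁ := norm_map_sum_smul_sub_le T hw₀ hw₁ fun i => (hz i).2.2.le
    have h₂ := norm_map_sum_smul_sub_le T₂ hw₀ hw₁ (z := z) (d := d) (η := η) fun i => by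
      rw [map_sub]
      exact (hsl i (z i) (hz i).1 (hz i).2.1).le
    have h₃ : ∑ i, w i • z i - y = (∑ i, w i • z i - ∑ i, w i • d i) + (∑ i, w i • d i - y) := by
      abel
    have h₄ := S.le_opNorm (∑ i, w i • d i - y)
    rw [dist_comm, dist_eq_norm] at hyd
    rw [h₃, map_add]
    refine (norm_add_le _ _).trans_lt ?_
    rw [hnorm]
    nlinarith
  · rw [add_comm]
    nlinarith

/-- For `g = f / ‖f‖` the operator `Id + g ⊗ x` has norm `2`. A vector almost attaining it, with
sign chosen so that `g w ≥ 0`, has `g w` almost `1`; hence it lies in the slice and is almost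
additive to `x`. -/
theorem DaugavetProperty.isDaugavetSet_slice [Nontrivial X] (hX : DaugavetProperty X)
    (f : X →L[ℝ] ℝ) {α : ℝ} (hα : α < ‖f‖) : IsDaugavetSet {z : X | ‖z‖ ≤ 1 ∧ α < f z} := by
  refine isDaugavetSet_of_unit (fun z hz => hz.1) fun x hx ε hε => ?_
  have hx0 : x ≠ 0 := by rintro rfl; simp at hx
  by_cases hf : f = 0
  · refine ⟨x, ⟨hx.le, by simpa [hf] using hα⟩, ?_⟩
    rw [← two_smul ℝ x, norm_smul, hx]
    norm_num
    exact hε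
  have hf' : 0 < ‖f‖ := norm_pos_iff.2 hf
  set g : X →L[ℝ] ℝ := ‖f‖⁻¹ • f with hg_def
  have hg : ‖g‖ = 1 := norm_smul_inv_norm hf
  have hg0 : g ≠ 0 := by rintro h; simp [h] at hg
  have hrank : Module.finrank ℝ (LinearMap.range (g.smulRight x : X →ₗ[ℝ] X)) = 1 := by
    have : LinearMap.range (g.smulRight x : X →ₗ[ℝ] X) = Submodule.span ℝ {x} := by
      refine le_antisymm ?_ ?_
      · rintro _ ⟨v, rfl⟩
        exact Submodule.smul_mem _ _ (Submodule.mem_span_singleton_self x)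
      · obtain ⟨v, hv⟩ := DFunLike.ne_iff.1 hg0
        rw [Submodule.span_singleton_le_iff_mem]
        refine ⟨(g v)⁻¹ • v, ?_⟩
        change g ((g v)⁻¹ • v) • x = x
        rw [map_smul, smul_eq_mul, inv_mul_cancel₀ hv, one_smul]
    rw [this, finrank_span_singleton hx0]
  have hnorm := hX _ hrank
  rw [ContinuousLinearMap.norm_smulRight_apply, hg, hx, mul_one] at hnorm
  set δ := min (ε / 2) (1 - α / ‖f‖) with hδ_def
  have hδ : 0 < δ := lt_min (by positivity) (by rw [sub_pos, div_lt_one hf']; exact hα)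
  obtain ⟨w, hw, hlt⟩ := (ContinuousLinearMap.id ℝ X + g.smulRight x).exists_lt_apply_of_lt_opNorm
    (show 2 - δ < ‖ContinuousLinearMap.id ℝ X + g.smulRight x‖ by rw [hnorm]; linarith)
  have hmain : ∀ w : X, ‖w‖ ≤ 1 → 0 ≤ g w → 2 - δ < ‖w + g w • x‖ →
      ∃ z ∈ {z : X | ‖z‖ ≤ 1 ∧ α < f z}, 2 - ε < ‖z + x‖ := by
    intro w hw hgw hlt
    have hgw1 : g w ≤ 1 := hg ▸ apply_le_opNorm_of_norm_le_one g hw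
    have h₁ : 1 - δ < g w := by
      have := norm_add_le w (g w • x)
      rw [norm_smul, hx, mul_one, Real.norm_of_nonneg hgw] at this
      linarith
    refine ⟨w, ⟨hw, ?_⟩, ?_⟩
    · have h₂ : α / ‖f‖ < g w := by
        have := min_le_right (ε / 2) (1 - α / ‖f‖)
        linarith
      have h₃ : g w = f w / ‖f‖ := by simp [hg_def, div_eq_inv_mul]
      rw [h₃] at h₂
      exact (div_lt_div_iff_of_pos_right hf').1 h₂
    · have h₂ : w + g w • x = (w + x) - (1 - g w) • x := by
        rw [sub_smul, one_smul]; abel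
      have h₃ := norm_sub_le (w + x) ((1 - g w) • x)
      rw [← h₂, norm_smul, hx, mul_one, Real.norm_of_nonneg (by linarith)] at h₃
      have := min_le_left (ε / 2) (1 - α / ‖f‖)
      linarith
  have hlt' : 2 - δ < ‖w + g w • x‖ := by simpa using hlt
  rcases le_total 0 (g w) with h | h
  · exact hmain w hw.le h hlt'
  · refine hmain (-w) (by rw [norm_neg]; exact hw.le) (by rw [map_neg]; linarith) ?_
    rwa [map_neg, neg_smul, ← neg_add, norm_neg]

/-- Take `z₁` where `f` is nearly maximal and `z₂` where it is nearly minimal, both almost additive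
to what precedes. The weights `(1 ± q) / 2` with `q = f y / ‖f‖` give the combination nearly the
value `f y`. -/
theorem DaugavetProperty.isNarrow_zero (hX : DaugavetProperty X) :
    IsNarrow (0 : X →L[ℝ] Y) := by
  intro f
  refine isStrongDaugavet_of_norm_le_one fun x y hx hy ε hε => ?_
  have := nontrivial_of_norm_eq_one hx
  set s := ‖f‖ with hs
  have hs0 : 0 ≤ s := norm_nonneg f
  have hfy : |f y| ≤ s := by
    have := f.le_opNorm y
    rwa [hy, mul_one] at this
  have hq : |f y / s| ≤ 1 := by
    rw [abs_div, abs_of_nonneg hs0]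
    exact div_le_one_of_le₀ hfy hs0
  -- This also holds for `s = 0`, where `q = 0` by convention and `f y = 0`.
  have hqs : f y / s * s = f y := by
    refine div_mul_cancel_of_imp fun h => ?_
    rw [h] at hfy
    exact abs_nonpos_iff.1 hfy
  set q := f y / s
  rw [abs_le] at hq
  obtain ⟨z₁, ⟨hz₁, hf₁⟩, hxz₁⟩ := hX.isDaugavetSet_slice f (α := s - ε / 2) (by linarith) x
    ((1 + q) / 2) (by linarith) (ε / 4) (by linarith)
  obtain ⟨z₂, ⟨hz₂, hf₂⟩, hxz₂⟩ := hX.isDaugavetSet_slice (-f) (α := s - ε / 2)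
    (by rw [norm_neg]; linarith) (x + ((1 + q) / 2) • z₁)
    ((1 - q) / 2) (by linarith) (ε / 4) (by linarith)
  have hf₁' := apply_le_opNorm_of_norm_le_one f hz₁
  have hf₂' := apply_le_opNorm_of_norm_le_one (-f) hz₂
  rw [norm_neg] at hf₂'
  rw [neg_apply] at hf₂ hf₂'
  refine ⟨((1 + q) / 2) • z₁ + ((1 - q) / 2) • z₂, ?_, ?_, ?_⟩
  · refine (norm_add_le _ _).trans ?_
    rw [norm_smul_of_nonneg (by linarith), norm_smul_of_nonneg (by linarith)]
    nlinarith
  · rw [norm_formalSum_apply]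
    rw [zero_apply, norm_zero, zero_add, map_sub, map_add, map_smul, map_smul, smul_eq_mul,
      smul_eq_mul, Real.norm_eq_abs, abs_lt]
    constructor <;> nlinarith
  · have h₁ : ((1 + q) / 2) • z₁ + ((1 - q) / 2) • z₂ + x =
      x + ((1 + q) / 2) • z₁ + ((1 - q) / 2) • z₂ := by abel
    rw [h₁]
    linarith

end Daugavet

/-! ### Passage to classes of operators -/

section Classes

variable {X : Type u} [NormedAddCommGroup X] [NormedSpace ℝ X]

theorem IsNarrow.congr_norm {Y : Type v} [NormedAddCommGroup Y] [NormedSpace ℝ Y] {Z : Type w}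
    [NormedAddCommGroup Z] [NormedSpace ℝ Z] {S : X →L[ℝ] Y} {T : X →L[ℝ] Z} (hS : IsNarrow S)
    (h : ∀ x, ‖S x‖ = ‖T x‖) : IsNarrow T := by
  intro f x y hx hy ε hε
  obtain ⟨z, hz, hSz, hzx⟩ := hS f x y hx hy ε hε
  exact ⟨z, hz, by rwa [norm_formalSum_apply, ← h, ← norm_formalSum_apply], hzx⟩

theorem isStrongRadonNikodym_zero {Y : Type v} [NormedAddCommGroup Y] [NormedSpace ℝ Y] :
    IsStrongRadonNikodym (0 : X →L[ℝ] Y) := by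
  intro Ω _ P _ m hm0 hmK
  refine ⟨fun _ => 0, integrable_zero _ _ _, fun A hA => ?_⟩
  rw [integral_zero]
  by_cases h : P A = 0
  · exact hm0 A hA h
  · have h₁ := hmK A hA (pos_iff_ne_zero.2 h)
    have h₂ : closure ((0 : X →L[ℝ] Y) '' Metric.closedBall (0 : X) 1) ⊆ {0} :=
      closure_minimal (by rintro _ ⟨x, _, rfl⟩; rfl) isClosed_singleton
    have h₃ : (P.real A)⁻¹ • m A = 0 := h₂ h₁
    have h₄ : (P.real A)⁻¹ ≠ 0 := inv_ne_zero (by simpa [measureReal_eq_zero_iff] using h)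
    exact (smul_eq_zero.1 h₃).resolve_left h₄

end Classes

theorem mainTheorem4 (X : Type u) [NormedAddCommGroup X] [NormedSpace ℝ X] [CompleteSpace X]
    (hX : DaugavetProperty X) :
    (∀ (Y : Type v) [NormedAddCommGroup Y] [NormedSpace ℝ Y] [CompleteSpace Y]
        (Y₁ : Type w) [NormedAddCommGroup Y₁] [NormedSpace ℝ Y₁] [CompleteSpace Y₁]
        (T : X →L[ℝ] Y) (T₁ : X →L[ℝ] Y₁),
        IsNarrow T → IsStrongRadonNikodym T₁ → IsNarrow (formalSum T T₁)) ∧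
    OP.setSum (OP.NAR.{u, v} X) (OP.SRN.{u, v} X) = OP.NAR.{u, v} X ∧
    (∀ (Y₁ : Type w) [NormedAddCommGroup Y₁] [NormedSpace ℝ Y₁] [CompleteSpace Y₁]
        (T₁ : X →L[ℝ] Y₁), IsStrongRadonNikodym T₁ → IsNarrow T₁) := by
  refine ⟨fun Y _ _ _ Y₁ _ _ _ T T₁ hT hT₁ => hT.formalSum_of_isStrongRadonNikodym hT₁, ?_,
    fun Y₁ _ _ _ T₁ hT₁ => ?_⟩
  · ext c
    constructor
    · rintro ⟨_, ⟨T, hT, rfl⟩, _, ⟨T₁, hT₁, rfl⟩, rfl⟩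
      exact ⟨⟨WithLp 1 (T.cod × T₁.cod), formalSum T.op T₁.op⟩,
        hT.formalSum_of_isStrongRadonNikodym hT₁, rfl⟩
    · rintro ⟨T, hT, rfl⟩
      -- A narrow class is its own sum with the class of the zero operator, which is strong
      -- Radon–Nikodým.
      refine ⟨_, ⟨T, hT, rfl⟩, _, ⟨⟨T.cod, (0 : X →L[ℝ] T.cod)⟩, isStrongRadonNikodym_zero, rfl⟩,
        Quotient.sound fun x => ?_⟩
      change ‖T.op x‖ = ‖formalSum T.op (0 : X →L[ℝ] T.cod) x‖
      rw [norm_formalSum_apply, zero_apply, norm_zero, add_zero]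
  · refine ((hX.isNarrow_zero (Y := Y₁)).formalSum_of_isStrongRadonNikodym hT₁).congr_norm
      fun x => ?_
    rw [norm_formalSum_apply, zero_apply, norm_zero, zero_add]
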